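/- Let $p$ be a prime, $K$ a commutative ring of characteristic $p$, and $R$ a commutative $K$-algebra. A Lie-Rinehart algebra over $R$ is a $K$-Lie algebra $L$ which is also an $R$-module (with compatible $K$-actions), with an $R$-linear homomorphism of $K$-Lie algebras $\epsilon\colon L\to\operatorname{Der}_K(R)$ (the anchor; write $x(r)=\epsilon(x)(r)$) such that $[x,ry]=r[x,y]+x(r)y$. It is restricted if it is equipped with a map $x\mapsto x^{[p]}$ on $L$ such that, for $k\in K$, $r\in R$, $x,y\in L$, $$(kx)^{[p]}=k^px^{[p]},\qquad [x^{[p]},y]=\operatorname{ad}(x)^p(y),\qquad (x+y)^{[p]}=x^{[p]}+y^{[p]}+\sum_{i=1}^{p-1}\lambda_i(x,y),$$ $$(rx)^{[p]}=r^px^{[p]}+(rx)^{p-1}(r)\,x,$$ where $i\lambda_i(x,y)$ is the coefficient of $t^{i-1}$ in $\operatorname{ad}(tx+y)^{p-1}(x)$ and $(rx)^{p-1}(r)=\epsilon(rx)^{p-1}(r)$. Let $(R,L)$ be a restricted Lie-Rinehart algebra, and let $S\subset R$ be a multiplicative set (for example $S=R\setminus\mathfrak p$ for a prime ideal $\mathfrak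 p$). Equip $(S^{-1}R,S^{-1}L)$ with its Lie-Rinehart structure $$(s^{-1}x)(t^{-1}r)=s^{-1}t^{-1}x(r)-s^{-1}t^{-2}x(t)r,\qquad [s^{-1}x,t^{-1}y]=s^{-1}t^{-1}[x,y]+(s^{-1}x)(t^{-1})\,y-(t^{-1}y)(s^{-1})\,x .$$ Then the rule $$(s^{-1}x)^{[p]}=s^{-p-1}\bigl(s\,x^{[p]}-x^{p-1}(s)\,x\bigr)\qquad(x\in L,\ s\in S)$$ gives a well-defined map on $S^{-1}L$, and with this map $(S^{-1}R,S^{-1}L)$ is a restricted Lie-Rinehart algebra; in particular, on $S^{-1}L$, the sum formula for $(a+b)^{[p]}$ and $[a^{[p]},b]=\operatorname{ad}(a)^p(b)$ hold. If moreover $\epsilon(x^{[p]})=\epsilon(x)^p$ for all $x\in L$, then the anchor of $S^{-1}L$ has the same property. Finally, the rule is forced: every map $x\mapsto x^{[p]}$ on $S^{-1}L$ which makes $(S^{-1}R,S^{-1}L)$ a restricted Lie-Rinehart algebra and satisfies $(x/1)^{[p]}=x^{[p]}/1$ for all $x\in L$ is given by this formula. -/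

import Mathlib

/-! ## Restricted Lie algebras and restricted Lie-Rinehart algebras -/

/-- `jacobsonCoeff a b n j` is the coefficient of `t ^ j` in `ad (t a + b) ^ n (a)`,
computed in `L[t]`. -/
def jacobsonCoeff {L : Type*} [LieRing L] (a b : L) : ℕ → ℕ → L
  | 0, 0 => a
  | 0, _ + 1 => 0
  | n + 1, 0 => ⁅b, jacobsonCoeff a b n 0⁆
  | n + 1, j + 1 => ⁅a, jacobsonCoeff a b n j⁆ + ⁅b, jacobsonCoeff a b n (j + 1)⁆

/-- Jacobson's Lie polynomial `λ_i(a, b)`, for `1 ≤ i ≤ p - 1`, on Lie rings of characteristic `p`: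
`i λ_i(a, b)` is the coefficient of `t ^ (i - 1)` in `ad (t a + b) ^ (p - 1) (a)`. The factor
`1 / i` is represented by the natural number below `p` which is inverse to `i` modulo `p`. -/
def jacobsonTerm {L : Type*} [LieRing L] (p : ℕ) (i : ℕ) (a b : L) : L :=
  ((i : ZMod p)⁻¹).val • jacobsonCoeff a b (p - 1) (i - 1)

/-- The map `pow`, written `x ↦ x^[p]`, is a `p`-operation on the `K`-Lie algebra `L`, so that `L`
becomes a restricted Lie algebra. -/
structure IsRestrictedLieAlgebra (K L : Type*) [CommRing K] [LieRing L] [LieAlgebra K L]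
    (p : ℕ) (pow : L → L) : Prop where
  pow_smul : ∀ (k : K) (x : L), pow (k • x) = k ^ p • pow x
  pow_lie : ∀ x y : L, ⁅pow x, y⁆ = (LieAlgebra.ad K L x ^ p) y
  pow_add : ∀ x y : L,
    pow (x + y) = pow x + pow y + ∑ i ∈ Finset.Icc 1 (p - 1), jacobsonTerm p i x y

/-- `(R, L)` with the `p`-operation `pow` is a restricted Lie-Rinehart algebra over `K`. Here
`⁅x, r⁆ = x(r)` is the action of `L` on `R` through the anchor. -/
structure IsRestrictedLieRinehart (K R L : Type*) [CommRing K] [CommRing R] [Algebra K R]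
    [LieRing L] [LieAlgebra K L] [Module R L] [LieRingModule L R] [LieRinehartRing R L]
    [LieRinehartAlgebra K R L] (p : ℕ) (pow : L → L) : Prop
    extends IsRestrictedLieAlgebra K L p pow where
  pow_smul_ring : ∀ (r : R) (x : L),
    pow (r • x) = r ^ p • pow x + ((LieModule.toEnd K L R (r • x) ^ (p - 1)) r) • x

/-- The anchor `L → Der_K(R)` takes the `p`-operation `pow` to the `p`-th power of derivations. -/
def AnchorIsRestricted (K R L : Type*) [CommRing K] [CommRing R] [Algebra K R]
    [LieRing L] [LieAlgebra K L] [Module R L] [LieRingModule L R] [LieRinehartRing R L]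
    [LieRinehartAlgebra K R L] (p : ℕ) (pow : L → L) : Prop :=
  ∀ (x : L) (r : R), ⁅pow x, r⁆ = (LieModule.toEnd K L R x ^ p) r

/-! ## The Lie-Rinehart structure on a localization -/

namespace LieRinehartLocalization

section Extend

variable {R M : Type*} [CommRing R] [AddCommGroup M] [Module R M] (S : Submonoid R)

theorem liftOn_wd {α : Type*} {f : M × S → α}
    (hf : ∀ (u : S) (m : M) (s : S), f (u • m, u * s) = f (m, s))
    (a b : M × S) (h : a ≈ b) : f a = f b := by
  obtain ⟨m, s⟩ := a
  obtain ⟨n, t⟩ := b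
  obtain ⟨u, hu⟩ := h
  simp only at hu
  rw [← hf (u * t) m s, ← hf (u * s) n t, mul_smul, mul_smul, hu]
  congr 2
  rw [mul_assoc, mul_assoc, mul_comm t s]

theorem mk_congr_denom (u : S) (m : M) (s : S) :
    LocalizedModule.mk (u • m) (u * s) = LocalizedModule.mk m s :=
  LocalizedModule.mk_cancel_common_left u s m

/-- Let `D` be a derivation of `R`, and `δ` an additive endomorphism of an `R`-module `M` with
`δ (r m) = r δ(m) + D(r) m`. Its extension to `S⁻¹M` is
`m / t ↦ (t δ(m) - D(t) m) / t ^ 2`. -/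
noncomputable def extend (D : Derivation ℤ R R) (δ : M →+ M)
    (h : ∀ (r : R) (m : M), δ (r • m) = r • δ m + D r • m) :
    LocalizedModule S M →+ LocalizedModule S M :=
  AddMonoidHom.mk'
    (fun q ↦ q.liftOn
      (fun a ↦ LocalizedModule.mk ((a.2 : R) • δ a.1 - D (a.2 : R) • a.1) (a.2 * a.2))
      (liftOn_wd S (by
        intro u m t
        rw [← mk_congr_denom S (u * u) _ (t * t)]
        congr 1
        · simp only [Submonoid.smul_def, Submonoid.coe_mul, h, Derivation.leibniz, smul_eq_mul]
          module
        · exact mul_mul_mul_comm _ _ _ _)))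
    (by
      intro a b
      induction a with | _ m s
      induction b with | _ n t
      rw [LocalizedModule.mk_add_mk]
      simp only [LocalizedModule.liftOn_mk]
      rw [LocalizedModule.mk_add_mk, LocalizedModule.mk_eq]
      refine ⟨1, ?_⟩
      simp only [Submonoid.smul_def, Submonoid.coe_mul, h, Derivation.leibniz, smul_eq_mul,
        map_add]
      module)

variable (D : Derivation ℤ R R) (δ : M →+ M)
    (h : ∀ (r : R) (m : M), δ (r • m) = r • δ m + D r • m)

theorem extend_mk (m : M) (t : S) :
    extend S D δ h (LocalizedModule.mk m t) =
      LocalizedModule.mk ((t : R) • δ m - D (t : R) • m) (t * t) := by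
  rfl

theorem extend_mk_one (m : M) :
    extend S D δ h (LocalizedModule.mk m 1) = LocalizedModule.mk (δ m) 1 := by
  rw [extend_mk]
  simp


/-- The extension of a derivation of `R` to `S⁻¹R`, by the quotient rule. -/
noncomputable def extendDer : Localization S →+ Localization S :=
  extend S D (D : R →+ R) (by intro r m; simp [mul_comm])

theorem extendDer_mk (r : R) (t : S) :
    extendDer S D (Localization.mk r t) = Localization.mk (t * D r - D t * r) (t * t) :=
  rfl

theorem extend_smul (q : Localization S) (b : LocalizedModule S M) :
    extend S D δ h (q • b) = q • extend S D δ h b + extendDer S D q • b := by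
  induction q using Localization.induction_on with | _ q
  obtain ⟨r, s⟩ := q
  induction b with | _ m t
  rw [LocalizedModule.mk_smul_mk, extend_mk, extend_mk, extendDer_mk, LocalizedModule.mk_smul_mk,
    LocalizedModule.mk_smul_mk, LocalizedModule.mk_add_mk, LocalizedModule.mk_eq]
  refine ⟨1, ?_⟩
  simp only [Submonoid.smul_def, Submonoid.coe_mul, h, Derivation.leibniz, smul_eq_mul]
  module

theorem extendDer_mul (q b : Localization S) :
    extendDer S D (q * b) = q * extendDer S D b + extendDer S D q * b :=
  extend_smul S D (D : R →+ R) (by intro r m; simp [mul_comm]) q b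

theorem smul_mk_one (m : M) (s : S) :
    LocalizedModule.mk m s = Localization.mk 1 s • LocalizedModule.mk m 1 := by
  rw [LocalizedModule.mk_smul_mk, one_smul, mul_one]

end Extend

section Structure

variable {R L : Type*} [CommRing R] [LieRing L] [Module R L] [LieRingModule L R]
  [LieRinehartRing R L] (S : Submonoid R)

/-- The derivation `r ↦ x(r)` of `R`. -/
def der (x : L) : Derivation ℤ R R :=
  Derivation.mk' (LieModule.toEnd ℤ L R x) (by
    intro a b
    simp [mul_comm b])

theorem der_apply (x : L) (r : R) : der x r = ⁅x, r⁆ := rfl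

/-- The extension of `ad x = ⁅x, ·⁆` to `S⁻¹L`. -/
noncomputable def extendAd (x : L) : LocalizedModule S L →+ LocalizedModule S L :=
  extend S (der (R := R) x) (LieModule.toEnd ℤ L L x).toAddMonoidHom (by
    intro r m
    simp [der_apply])

theorem extendAd_mk_one (x y : L) :
    extendAd S x (LocalizedModule.mk y 1) = LocalizedModule.mk ⁅x, y⁆ 1 :=
  extend_mk_one S _ _ _ y

theorem extendAd_smul (x : L) (q : Localization S) (b : LocalizedModule S L) :
    extendAd S x (q • b) = q • extendAd S x b + extendDer S (der x) q • b :=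
  extend_smul S _ _ _ q b

/-- The anchor of `S⁻¹L`: `(x / s)(q) = x(q) / s`. -/
noncomputable def anchor (a : LocalizedModule S L) : Localization S →+ Localization S :=
  a.liftOn (fun a ↦ (Localization.mk 1 a.2 : Localization S) • extendDer S (der a.1))
    (liftOn_wd S (by
      intro u x s
      ext q
      induction q using Localization.induction_on with | _ q
      obtain ⟨r, t⟩ := q
      simp only [AddMonoidHom.smul_apply, extendDer_mk, der_apply, smul_eq_mul,
        Localization.mk_mul, Submonoid.smul_def, LieRinehartRing.lie_smul_eq_mul]
      rw [Localization.mk_eq_mk_iff, Localization.r_iff_exists]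
      refine ⟨1, ?_⟩
      simp only [Submonoid.coe_mul]
      ring))

theorem anchor_mk (x : L) (s : S) (q : Localization S) :
    anchor S (LocalizedModule.mk x s) q = Localization.mk 1 s * extendDer S (der x) q :=
  rfl

theorem anchor_mk_mk (x : L) (s : S) (r : R) (t : S) :
    anchor S (LocalizedModule.mk x s) (Localization.mk r t) =
      Localization.mk ((t : R) * ⁅x, r⁆ - ⁅x, (t : R)⁆ * r) (s * (t * t)) := by
  rw [anchor_mk, extendDer_mk, Localization.mk_mul, one_mul]
  rfl

theorem anchor_mul (a : LocalizedModule S L) (q q' : Localization S) :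
    anchor S a (q * q') = q * anchor S a q' + anchor S a q * q' := by
  induction a with | _ x s
  simp only [anchor_mk, extendDer_mul]
  ring

theorem anchor_add (a b : LocalizedModule S L) (q : Localization S) :
    anchor S (a + b) q = anchor S a q + anchor S b q := by
  induction a with | _ x s
  induction b with | _ y t
  induction q using Localization.induction_on with | _ q
  obtain ⟨r, v⟩ := q
  rw [LocalizedModule.mk_add_mk]
  simp only [anchor_mk_mk, Localization.add_mk, Submonoid.smul_def, add_lie,
    LieRinehartRing.lie_smul_eq_mul]
  rw [Localization.mk_eq_mk_iff, Localization.r_iff_exists]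
  refine ⟨1, ?_⟩
  simp only [Submonoid.coe_mul]
  ring

theorem anchor_smul (q : Localization S) (a : LocalizedModule S L) (q' : Localization S) :
    anchor S (q • a) q' = q * anchor S a q' := by
  induction a with | _ x s
  induction q using Localization.induction_on with | _ q
  induction q' using Localization.induction_on with | _ q'
  obtain ⟨r, t⟩ := q
  obtain ⟨r', t'⟩ := q'
  rw [LocalizedModule.mk_smul_mk]
  simp only [anchor_mk_mk, Localization.mk_mul, LieRinehartRing.lie_smul_eq_mul]
  rw [Localization.mk_eq_mk_iff, Localization.r_iff_exists]
  refine ⟨1, ?_⟩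
  simp only [Submonoid.coe_mul]
  ring

theorem lie_smul_left (r : R) (x y : L) : ⁅r • x, y⁆ = r • ⁅x, y⁆ - ⁅y, r⁆ • x := by
  rw [← lie_skew, LieRinehartRing.leibniz_smul_right, ← lie_skew x y]
  module

theorem extendAd_mk (x y : L) (t : S) :
    extendAd S x (LocalizedModule.mk y t) =
      LocalizedModule.mk ((t : R) • ⁅x, y⁆ - ⁅x, (t : R)⁆ • y) (t * t) :=
  rfl

/-- The Lie bracket of `S⁻¹L`: `⁅x / s, b⁆ = ⁅x, b⁆ / s - b(1 / s) x`. -/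
noncomputable def bracket (a b : LocalizedModule S L) : LocalizedModule S L :=
  a.liftOn (fun a ↦ (Localization.mk 1 a.2 : Localization S) • extendAd S a.1 b -
      anchor S b (Localization.mk 1 a.2) • LocalizedModule.mk a.1 1)
    (liftOn_wd S (by
      intro u x s
      induction b with | _ y t
      simp only [extendAd_mk, anchor_mk_mk, LocalizedModule.mk_smul_mk, sub_eq_add_neg,
        ← LocalizedModule.mk_neg, LocalizedModule.mk_add_mk, LocalizedModule.mk_eq]
      refine ⟨1, ?_⟩
      have h1 : ⁅y, (1 : R)⁆ = 0 := by
        have := LieRinehartRing.leibniz_mul_right y (1 : R) 1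
        simpa using this
      simp only [Submonoid.smul_def, Submonoid.coe_mul, lie_smul_left,
        LieRinehartRing.lie_smul_eq_mul, LieRinehartRing.leibniz_mul_right, smul_eq_mul,
        one_smul, h1]
      module))

/-- The explicit formula for the bracket of two fractions. -/
theorem bracket_mk_mk (x y : L) (s t : S) :
    bracket S (LocalizedModule.mk x s) (LocalizedModule.mk y t) =
      (Localization.mk 1 (s * t) : Localization S) • LocalizedModule.mk ⁅x, y⁆ 1
        + (anchor S (LocalizedModule.mk x s) (Localization.mk 1 t)) • LocalizedModule.mk y 1
        - (anchor S (LocalizedModule.mk y t) (Localization.mk 1 s)) • LocalizedModule.mk x 1 := by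
  have h1 (y : L) : ⁅y, (1 : R)⁆ = 0 := by
    have := LieRinehartRing.leibniz_mul_right y (1 : R) 1
    simpa using this
  change (Localization.mk 1 s : Localization S) • extendAd S x _ - _ = _
  congr 1
  simp only [extendAd_mk, anchor_mk_mk, LocalizedModule.mk_smul_mk, sub_eq_add_neg,
    LocalizedModule.mk_add_mk, LocalizedModule.mk_eq]
  refine ⟨1, ?_⟩
  simp only [Submonoid.smul_def, Submonoid.coe_mul, one_smul, h1]
  module

theorem bracket_skew (a b : LocalizedModule S L) : bracket S a b = -bracket S b a := by
  induction a with | _ x s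
  induction b with | _ y t
  rw [bracket_mk_mk, bracket_mk_mk, ← lie_skew x y, LocalizedModule.mk_neg, mul_comm t s, smul_neg]
  abel

theorem bracket_add (a b c : LocalizedModule S L) :
    bracket S a (b + c) = bracket S a b + bracket S a c := by
  induction a with | _ x s
  change (Localization.mk 1 s : Localization S) • extendAd S x _ - _ • _ =
    ((Localization.mk 1 s : Localization S) • extendAd S x _ - _ • _) +
    ((Localization.mk 1 s : Localization S) • extendAd S x _ - _ • _)
  rw [map_add, anchor_add, smul_add, add_smul]
  abel

theorem add_bracket (a b c : LocalizedModule S L) :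
    bracket S (a + b) c = bracket S a c + bracket S b c := by
  rw [bracket_skew, bracket_add, bracket_skew S c a, bracket_skew S c b]
  abel

theorem bracket_self (a : LocalizedModule S L) : bracket S a a = 0 := by
  induction a with | _ x s
  rw [bracket_mk_mk, lie_self, LocalizedModule.zero_mk, smul_zero,
    zero_add, sub_self]

theorem bracket_smul (a : LocalizedModule S L) (q : Localization S) (b : LocalizedModule S L) :
    bracket S a (q • b) = q • bracket S a b + anchor S a q • b := by
  induction a with | _ x s
  change (Localization.mk 1 s : Localization S) • extendAd S x _ - _ • _ =
    q • ((Localization.mk 1 s : Localization S) • extendAd S x _ - _ • _) + _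
  rw [extendAd_smul, anchor_smul, anchor_mk, smul_add, smul_sub, mul_smul, mul_smul,
    smul_comm q (Localization.mk 1 s : Localization S)]
  abel

theorem smul_bracket (q : Localization S) (a b : LocalizedModule S L) :
    bracket S (q • a) b = q • bracket S a b - anchor S b q • a := by
  rw [bracket_skew, bracket_smul, bracket_skew S b a, smul_neg]
  abel

theorem bracket_mk_one (x y : L) :
    bracket S (LocalizedModule.mk x 1) (LocalizedModule.mk y 1) = LocalizedModule.mk ⁅x, y⁆ 1 := by
  change (Localization.mk 1 1 : Localization S) • extendAd S x _ -
    anchor S _ (Localization.mk 1 1) • _ = _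
  have h : anchor S (LocalizedModule.mk y 1) (Localization.mk 1 1 : Localization S) = 0 := by
    rw [Localization.mk_one]
    simpa using anchor_mul S (LocalizedModule.mk y 1) 1 1
  rw [h, extendAd_mk_one, Localization.mk_one, one_smul, zero_smul, sub_zero]

theorem anchor_one (a : LocalizedModule S L) : anchor S a 1 = 0 := by
  simpa using anchor_mul S a 1 1

theorem anchor_mk_one (x : L) (r : R) :
    anchor S (LocalizedModule.mk x 1) (Localization.mk r 1) = Localization.mk ⁅x, r⁆ 1 := by
  have h1 : ⁅x, (1 : R)⁆ = 0 := by
    have := LieRinehartRing.leibniz_mul_right x (1 : R) 1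
    simpa using this
  rw [anchor_mk_mk]
  simp [h1]

/-- The anchor is a homomorphism of Lie rings. -/
theorem anchor_bracket (a b : LocalizedModule S L) (q : Localization S) :
    anchor S (bracket S a b) q = anchor S a (anchor S b q) - anchor S b (anchor S a q) := by
  induction a with | _ x s
  induction b with | _ y t
  rw [smul_mk_one S x s, smul_mk_one S y t]
  generalize (Localization.mk 1 s : Localization S) = c
  generalize (Localization.mk 1 t : Localization S) = d
  have key : ∀ q : Localization S,
      anchor S (LocalizedModule.mk ⁅x, y⁆ 1) q =
        anchor S (LocalizedModule.mk x 1) (anchor S (LocalizedModule.mk y 1) q) -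
        anchor S (LocalizedModule.mk y 1) (anchor S (LocalizedModule.mk x 1) q) := by
    intro q
    induction q using Localization.induction_on with | _ q
    obtain ⟨r, v⟩ := q
    have base : ∀ r : R, anchor S (LocalizedModule.mk ⁅x, y⁆ 1) (Localization.mk r 1) =
        anchor S (LocalizedModule.mk x 1) (anchor S (LocalizedModule.mk y 1)
          (Localization.mk r 1)) -
        anchor S (LocalizedModule.mk y 1) (anchor S (LocalizedModule.mk x 1)
          (Localization.mk r 1)) := by
      intro r
      simp only [anchor_mk_one]
      rw [lie_lie, sub_eq_add_neg, ← Localization.add_mk_self, ← Localization.neg_mk,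
        ← sub_eq_add_neg]
    have hv : (Localization.mk (v : R) 1 : Localization S) * Localization.mk 1 v = 1 := by
      rw [Localization.mk_mul, one_mul, mul_one, Localization.mk_self]
    have hr : (Localization.mk r v : Localization S) =
        Localization.mk r 1 * Localization.mk 1 v := by
      rw [Localization.mk_mul, one_mul, mul_one]
    have bv := base v
    have br := base r
    rw [hr]
    generalize (Localization.mk (v : R) 1 : Localization S) = w at *
    generalize (Localization.mk 1 v : Localization S) = w' at *
    generalize (Localization.mk r 1 : Localization S) = r' at *
    have e1 := congrArg (anchor S (LocalizedModule.mk ⁅x, y⁆ 1)) hv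
    have e2 := congrArg (fun z ↦ anchor S (LocalizedModule.mk x 1)
      (anchor S (LocalizedModule.mk y 1) z)) hv
    have e3 := congrArg (fun z ↦ anchor S (LocalizedModule.mk y 1)
      (anchor S (LocalizedModule.mk x 1) z)) hv
    simp only [anchor_mul, anchor_one, map_add, map_zero] at e1 e2 e3 ⊢
    rw [bv] at e1
    rw [br]
    linear_combination r' * w' * (e1 - e2 + e3) - (r' * hv) *
      (anchor S (LocalizedModule.mk ⁅x, y⁆ 1) w' -
        anchor S (LocalizedModule.mk x 1) (anchor S (LocalizedModule.mk y 1) w') +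
        anchor S (LocalizedModule.mk y 1) (anchor S (LocalizedModule.mk x 1) w'))
  simp only [bracket_smul, smul_bracket, anchor_smul, anchor_mul, bracket_mk_one, anchor_add,
    sub_eq_add_neg, ← neg_smul, key]
  ring

theorem jacobi_aux {A M : Type*} [CommRing A] [AddCommGroup M] [Module A M]
    (br : M → M → M) (an : M → A →+ A) (skew : ∀ a b, br a b = -br b a)
    (br_add : ∀ a b c, br a (b + c) = br a b + br a c)
    (an_add : ∀ a b q, an (a + b) q = an a q + an b q)
    (an_smul : ∀ q a q', an (q • a) q' = q * an a q')
    (an_mul : ∀ a q q', an a (q * q') = q * an a q' + an a q * q')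
    (br_smul : ∀ a q b, br a (q • b) = q • br a b + an a q • b)
    (an_br : ∀ a b q, an (br a b) q = an a (an b q) - an b (an a q))
    (x y z : M) (c d e : A) (base : br x (br y z) = br (br x y) z + br y (br x z)) :
    br (c • x) (br (d • y) (e • z)) =
      br (br (c • x) (d • y)) (e • z) + br (d • y) (br (c • x) (e • z)) := by
  have smul_br (q : A) (a b : M) : br (q • a) b = q • br a b - an b q • a := by
    rw [skew, br_smul, skew b a]
    module
  have add_br (a b c : M) : br (a + b) c = br a c + br b c := by
    rw [skew, br_add, skew c a, skew c b]
    abel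
  simp only [br_smul, smul_br, an_add, an_smul, an_mul, br_add, add_br,
    sub_eq_add_neg, ← neg_smul, an_br, base, map_neg]
  rw [skew y x]
  module

theorem bracket_jacobi (a b c : LocalizedModule S L) :
    bracket S a (bracket S b c) = bracket S (bracket S a b) c + bracket S b (bracket S a c) := by
  induction a with | _ x s
  induction b with | _ y t
  induction c with | _ z v
  have base : bracket S (LocalizedModule.mk x 1)
        (bracket S (LocalizedModule.mk y 1) (LocalizedModule.mk z 1)) =
      bracket S (bracket S (LocalizedModule.mk x 1) (LocalizedModule.mk y 1))
        (LocalizedModule.mk z 1) +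
      bracket S (LocalizedModule.mk y 1)
        (bracket S (LocalizedModule.mk x 1) (LocalizedModule.mk z 1)) := by
    simp only [bracket_mk_one]
    rw [leibniz_lie x y z, LocalizedModule.mk_add_mk]
    simp
  have h1 := jacobi_aux (A := Localization S) (M := LocalizedModule S L) (bracket S)
    (fun a ↦ anchor S a) (bracket_skew S) (bracket_add S) (anchor_add S) (anchor_smul S)
    (anchor_mul S)
  have h2 := h1 (by
    intro a q b
    refine (bracket_smul S a q b).trans ?_
    congr 1)
  have h := h2 (anchor_bracket S) _ _ _ (Localization.mk 1 s) (Localization.mk 1 t)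
    (Localization.mk 1 v) base
  rwa [← smul_mk_one S x s, ← smul_mk_one S y t, ← smul_mk_one S z v] at h

end Structure

section Instances

variable {R L : Type*} [CommRing R] [LieRing L] [Module R L] [LieRingModule L R]
  [LieRinehartRing R L] (S : Submonoid R)

/-- The Lie ring `S⁻¹L`. -/
noncomputable instance instLieRingLocalized : LieRing (LocalizedModule S L) where
  __ := (inferInstance : AddCommGroup (LocalizedModule S L))
  bracket := bracket S
  add_lie := add_bracket S
  lie_add := bracket_add S
  lie_self := bracket_self S
  leibniz_lie := bracket_jacobi S

/-- The action of `S⁻¹L` on `S⁻¹R`. -/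
noncomputable instance instLieRingModuleLocalized : LieRingModule (LocalizedModule S L) (Localization S) where
  bracket a := anchor S a
  add_lie := anchor_add S
  lie_add a := map_add (anchor S a)
  leibniz_lie a b q := by
    change anchor S a (anchor S b q) = anchor S (bracket S a b) q + anchor S b (anchor S a q)
    rw [anchor_bracket]
    ring

instance instLieRinehartRingLocalized : LieRinehartRing (Localization S) (LocalizedModule S L) where
  lie_smul_eq_mul' q q' a := anchor_smul S q a q'
  leibniz_mul_right' a q q' := anchor_mul S a q q'
  leibniz_smul_right' a b q := bracket_smul S a q b

variable (K : Type*) [CommRing K] [Algebra K R] [LieAlgebra K L] [LieRinehartAlgebra K R L]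

theorem lie_algebraMap (k : K) (a : LocalizedModule S L) :
    anchor S a (algebraMap K (Localization S) k) = 0 := by
  induction a with | _ x s
  have h1 (x : L) : ⁅x, (1 : R)⁆ = 0 := by
    have := LieRinehartRing.leibniz_mul_right x (1 : R) 1
    simpa using this
  have h2 : ⁅x, k • (1 : R)⁆ = k • ⁅x, (1 : R)⁆ := LieModule.lie_smul k x (1 : R)
  rw [← Localization.mk_algebraMap, anchor_mk_mk, Algebra.algebraMap_eq_smul_one, h2]
  simp [h1, Localization.mk_zero]

noncomputable instance instLieAlgebraLocalized : LieAlgebra K (LocalizedModule S L) where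
  __ := (inferInstance : Module K (LocalizedModule S L))
  lie_smul k a b := by
    have h := lie_algebraMap S K k a
    change bracket S a (k • b) = k • bracket S a b
    rw [← algebraMap_smul (Localization S) k b, bracket_smul, h, zero_smul, add_zero,
      algebraMap_smul]

instance instLieRinehartAlgebraLocalized :
    LieRinehartAlgebra K (Localization S) (LocalizedModule S L) where
  smul_assoc k q a := smul_assoc k q a
  smul_lie k a q := by
    change anchor S (k • a) q = k • anchor S a q
    rw [← algebraMap_smul (Localization S) k a, anchor_smul, Algebra.smul_def]
  lie_smul k a q := by
    have h := lie_algebraMap S K k a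
    change anchor S a (k • q) = k • anchor S a q
    rw [Algebra.smul_def, anchor_mul, h, zero_mul, add_zero, Algebra.smul_def]

end Instances

end LieRinehartLocalization

/-! In characteristic `p` every derivation kills `p`-th powers, so `s ^ p` and `1 / s ^ p` are
constants of the anchors of `L` and `S⁻¹L`. Every fraction can be written over such a denominator:
`x / s = s ^ (p - 1) x / s ^ p`.

For a constant `c` the bracket is `c`-bilinear, and the rule for `(r x)^[p]` reduces to `(c x)^[p] =
c ^ p x^[p]`, because `(c x) ^ (p - 1) (c) = 0` (`IsRestrictedLieRinehart.pow_const_smul`). Hence a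
`p`-operation extending that of `L` must send `x / s` to `(s ^ (p - 1) x)^[p] / s ^ (p * p)`. This
proves uniqueness, and the same homogeneity makes the expression well defined (`powLocalized`).
Comparing two evaluations of `(s ^ p x)^[p]` turns it into the stated formula
(`powLocalized_mk_eq`).

Each axiom is homogeneous under constants. With constant denominators the scalars factor out of both
sides, and the axiom for `L` remains. -/

/-! ### Brackets and adjoint powers under constants of the anchor -/

section AdjointPower

variable {K R L : Type*} [CommRing K] [CommRing R] [LieRing L] [LieAlgebra K L] [Module R L]
  [LieRingModule L R] [LieRinehartRing R L]

/-- The hypothesis `hc` makes `c` a constant, so the derivation term of the Leibniz rule vanishes.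
-/
theorem lie_const_smul {c : R} (hc : ∀ x : L, ⁅x, c⁆ = 0) (x y : L) : ⁅x, c • y⁆ = c • ⁅x, y⁆ := by
  rw [LieRinehartRing.leibniz_smul_right, hc, zero_smul, add_zero]

theorem const_smul_lie {c : R} (hc : ∀ x : L, ⁅x, c⁆ = 0) (x y : L) : ⁅c • x, y⁆ = c • ⁅x, y⁆ := by
  rw [← lie_skew, lie_const_smul hc, ← lie_skew x y, smul_neg]

theorem ad_pow_const_smul {c : R} (hc : ∀ x : L, ⁅x, c⁆ = 0) (x : L) (n : ℕ) (y : L) :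
    (LieAlgebra.ad K L x ^ n) (c • y) = c • (LieAlgebra.ad K L x ^ n) y := by
  induction n generalizing y with
  | zero => simp
  | succ n ih =>
    simp only [pow_succ, Module.End.mul_apply, LieAlgebra.ad_apply, lie_const_smul hc, ih]

theorem ad_const_smul_pow {c : R} (hc : ∀ x : L, ⁅x, c⁆ = 0) (x : L)
    (n : ℕ) (y : L) :
    (LieAlgebra.ad K L (c • x) ^ n) y = c ^ n • (LieAlgebra.ad K L x ^ n) y := by
  induction n generalizing y with
  | zero => simp
  | succ n ih =>
    simp only [pow_succ, Module.End.mul_apply, LieAlgebra.ad_apply, ih, const_smul_lie hc,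
      ad_pow_const_smul hc, mul_smul]

end AdjointPower

/-! ### Constants, the anchor and Jacobson's polynomials -/

section LieRinehart

variable {K R L : Type*} [CommRing K] [CommRing R] [Algebra K R]
  [LieRing L] [LieAlgebra K L] [Module R L] [LieRingModule L R] [LieRinehartRing R L]
  [LieRinehartAlgebra K R L]

theorem natCast_eq_zero_of_algebra (K : Type*) {R : Type*} [CommRing K] [CommRing R] [Algebra K R]
    (p : ℕ) [CharP K p] : (p : R) = 0 := by
  rw [← map_natCast (algebraMap K R), CharP.cast_eq_zero, map_zero]

theorem LieRinehartRing.lie_pow (x : L) (r : R) (n : ℕ) :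
    ⁅x, r ^ n⁆ = (n : R) * r ^ (n - 1) * ⁅x, r⁆ := by
  have h := Derivation.leibniz_pow (LieRinehartLocalization.der x) r n
  rwa [LieRinehartLocalization.der_apply, LieRinehartLocalization.der_apply, nsmul_eq_mul,
    smul_eq_mul, ← mul_assoc] at h

/-- In characteristic `p`, the anchor kills `p`-th powers. -/
theorem LieRinehartRing.lie_pow_char {p : ℕ} (h : (p : R) = 0) (x : L) (r : R) :
    ⁅x, r ^ p⁆ = 0 := by
  rw [LieRinehartRing.lie_pow, h, zero_mul, zero_mul]

/-- Used with `n = p - 1` to kill the correction term in the rule for `(c x)^[p]`. -/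
theorem toEnd_pow_eq_zero {n : ℕ} (hn : n ≠ 0) {x : L} {c : R} (hc : ⁅x, c⁆ = 0) :
    (LieModule.toEnd K L R x ^ n) c = 0 := by
  obtain ⟨n, rfl⟩ := Nat.exists_eq_succ_of_ne_zero hn
  rw [pow_succ, Module.End.mul_apply, LieModule.toEnd_apply_apply, hc, map_zero]

theorem lie_const_mul {c : R} (hc : ∀ x : L, ⁅x, c⁆ = 0)
    (x : L) (r : R) : ⁅x, c * r⁆ = c * ⁅x, r⁆ := by
  rw [LieRinehartRing.leibniz_mul_right, hc, zero_mul, add_zero, smul_eq_mul]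

theorem toEnd_pow_const_mul {c : R} (hc : ∀ x : L, ⁅x, c⁆ = 0)
    (x : L) (n : ℕ) (r : R) :
    (LieModule.toEnd K L R x ^ n) (c * r) = c * (LieModule.toEnd K L R x ^ n) r := by
  induction n generalizing r with
  | zero => simp
  | succ n ih =>
    simp only [pow_succ, Module.End.mul_apply, LieModule.toEnd_apply_apply, lie_const_mul hc, ih]

theorem toEnd_const_smul_pow {c : R} (hc : ∀ x : L, ⁅x, c⁆ = 0)
    (x : L) (n : ℕ) (r : R) :
    (LieModule.toEnd K L R (c • x) ^ n) r = c ^ n * (LieModule.toEnd K L R x ^ n) r := by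
  induction n generalizing r with
  | zero => simp
  | succ n ih =>
    simp only [pow_succ, Module.End.mul_apply, LieModule.toEnd_apply_apply, ih,
      LieRinehartRing.lie_smul_eq_mul,
      toEnd_pow_const_mul hc]
    ring

/-- Each coefficient is a sum of `n`-fold brackets with `n + 1` entries, and constants come out of
every entry. -/
theorem jacobsonCoeff_const_smul {c : R} (hc : ∀ x : L, ⁅x, c⁆ = 0)
    (x y : L) (n j : ℕ) :
    jacobsonCoeff (c • x) (c • y) n j = c ^ (n + 1) • jacobsonCoeff x y n j := by
  -- The induction hypothesis puts a power of `c` in the second slot of a bracket, so powers of `c`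
  -- must be constants too.
  have hcn (m : ℕ) (z : L) : ⁅z, c ^ m⁆ = 0 := by
    rw [LieRinehartRing.lie_pow, hc, mul_zero]
  induction n generalizing j with
  | zero => cases j <;> simp [jacobsonCoeff]
  | succ n ih =>
    cases j <;>
    · simp only [jacobsonCoeff, ih, const_smul_lie hc, lie_const_smul (hcn _), smul_smul, smul_add]
      simp only [← pow_succ']

theorem jacobsonTerm_const_smul {c : R} (hc : ∀ x : L, ⁅x, c⁆ = 0)
    {p : ℕ} (hp : p ≠ 0) (i : ℕ) (x y : L) :
    jacobsonTerm p i (c • x) (c • y) = c ^ p • jacobsonTerm p i x y := by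
  rw [jacobsonTerm, jacobsonTerm, jacobsonCoeff_const_smul hc, Nat.sub_add_cancel
    (Nat.one_le_iff_ne_zero.mpr hp), smul_comm]

/-- A `p`-operation is `p`-homogeneous over the constants of the anchor. -/
theorem IsRestrictedLieRinehart.pow_const_smul {c : R} (hc : ∀ x : L, ⁅x, c⁆ = 0)
    {p : ℕ} (hp : p.Prime) {pow : L → L}
    (hpow : IsRestrictedLieRinehart K R L p pow) (x : L) : pow (c • x) = c ^ p • pow x := by
  rw [hpow.pow_smul_ring, toEnd_pow_eq_zero (Nat.sub_ne_zero_of_lt hp.one_lt) (hc _), zero_smul,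
    add_zero]

end LieRinehart

/-- The coefficients are universal bracket expressions; the map of interest is `x ↦ x / 1`. -/
theorem jacobsonCoeff_map {L M : Type*} [LieRing L] [LieRing M] (f : L →+ M)
    (hf : ∀ x y, f ⁅x, y⁆ = ⁅f x, f y⁆) (x y : L) (n j : ℕ) :
    f (jacobsonCoeff x y n j) = jacobsonCoeff (f x) (f y) n j := by
  induction n generalizing j with
  | zero => cases j <;> simp [jacobsonCoeff]
  | succ n ih => cases j <;> simp only [jacobsonCoeff, map_add, hf, ih]

theorem jacobsonTerm_map {L M : Type*} [LieRing L] [LieRing M] (f : L →+ M)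
    (hf : ∀ x y, f ⁅x, y⁆ = ⁅f x, f y⁆) (p i : ℕ) (x y : L) :
    f (jacobsonTerm p i x y) = jacobsonTerm p i (f x) (f y) := by
  rw [jacobsonTerm, jacobsonTerm, map_nsmul, jacobsonCoeff_map f hf]

/-! ### Fractions with `p`-th power denominators -/

namespace LieRinehartLocalization

section Fractions

variable {R M : Type*} [CommRing R] [AddCommGroup M] [Module R M] (S : Submonoid R)

theorem exists_mk_eq_const_smul {p : ℕ} (hp : p ≠ 0) (a : LocalizedModule S M) :
    ∃ (s : S) (x : M), a = (Localization.mk 1 (s ^ p) : Localization S) • LocalizedModule.mk x 1 := by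
  induction a with | _ x s
  -- Expand the fraction by `s ^ (p - 1)`.
  refine ⟨s, s ^ (p - 1) • x, ?_⟩
  rw [← smul_mk_one, ← LocalizedModule.mk_cancel_common_left (s ^ (p - 1)) s x,
    pow_sub_one_mul hp]

theorem exists_mk_eq_const_mul {p : ℕ} (hp : p ≠ 0) (q : Localization S) :
    ∃ (s : S) (r : R), q = Localization.mk 1 (s ^ p) * Localization.mk r 1 := by
  induction q using Localization.induction_on with | _ q
  obtain ⟨r, s⟩ := q
  refine ⟨s, (s : R) ^ (p - 1) * r, ?_⟩
  rw [Localization.mk_mul, one_mul, mul_one, Localization.mk_eq_mk_iff, Localization.r_iff_exists]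
  refine ⟨1, ?_⟩
  simp only [SubmonoidClass.coe_pow, ← pow_sub_one_mul hp (s : R)]
  ring

theorem exists_common_mk_eq_const_smul {p : ℕ} (hp : p ≠ 0) (a b : LocalizedModule S M) :
    ∃ (s : S) (x y : M),
      a = (Localization.mk 1 (s ^ p) : Localization S) • LocalizedModule.mk x 1 ∧
      b = (Localization.mk 1 (s ^ p) : Localization S) • LocalizedModule.mk y 1 := by
  obtain ⟨s, x, rfl⟩ := exists_mk_eq_const_smul S hp a
  obtain ⟨t, y, rfl⟩ := exists_mk_eq_const_smul S hp b
  -- The product of the denominators `s ^ p` and `t ^ p` is again a `p`-th power.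
  refine ⟨s * t, t ^ p • x, s ^ p • y, ?_, ?_⟩
  · rw [← smul_mk_one, ← smul_mk_one, mul_pow, mul_comm, LocalizedModule.mk_cancel_common_left]
  · rw [← smul_mk_one, ← smul_mk_one, mul_pow, LocalizedModule.mk_cancel_common_left]

end Fractions

/-! ### Compatibility of `x ↦ x / 1` with the structure -/

variable {K R L : Type*} [CommRing K] [CommRing R] [Algebra K R]
  [LieRing L] [LieAlgebra K L] [Module R L] [LieRingModule L R] [LieRinehartRing R L]
  [LieRinehartAlgebra K R L] (S : Submonoid R)

theorem lie_mk_one (x y : L) :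
    ⁅(LocalizedModule.mk x 1 : LocalizedModule S L), (LocalizedModule.mk y 1 : LocalizedModule S L)⁆ =
      LocalizedModule.mk ⁅x, y⁆ 1 :=
  bracket_mk_one S x y

theorem mk_one_lie_mk_one (x : L) (r : R) :
    ⁅(LocalizedModule.mk x 1 : LocalizedModule S L), (Localization.mk r 1 : Localization S)⁆ =
      Localization.mk ⁅x, r⁆ 1 :=
  anchor_mk_one S x r

theorem toEnd_mk_one_pow (x : L) (n : ℕ) (r : R) :
    (LieModule.toEnd K (LocalizedModule S L) (Localization S) (LocalizedModule.mk x 1) ^ n)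
      (Localization.mk r 1) = Localization.mk ((LieModule.toEnd K L R x ^ n) r) 1 := by
  induction n generalizing r with
  | zero => simp
  | succ n ih =>
    simp only [pow_succ, Module.End.mul_apply, LieModule.toEnd_apply_apply, mk_one_lie_mk_one, ih]

theorem ad_mk_one_pow (x : L) (n : ℕ) (y : L) :
    (LieAlgebra.ad K (LocalizedModule S L) (LocalizedModule.mk x 1) ^ n)
      (LocalizedModule.mk y 1) = LocalizedModule.mk ((LieAlgebra.ad K L x ^ n) y) 1 := by
  induction n generalizing y with
  | zero => simp
  | succ n ih =>
    simp only [pow_succ, Module.End.mul_apply, LieAlgebra.ad_apply, lie_mk_one, ih]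

theorem jacobsonTerm_mk_one (p i : ℕ) (x y : L) :
    jacobsonTerm p i (LocalizedModule.mk x 1 : LocalizedModule S L) (LocalizedModule.mk y 1) =
      LocalizedModule.mk (jacobsonTerm p i x y) 1 :=
  (jacobsonTerm_map (LocalizedModule.mkLinearMap S L).toAddMonoidHom
    (fun x y ↦ (lie_mk_one S x y).symm) p i x y).symm

/-- In characteristic `p`, the fractions `1 / s ^ p` are constants of the anchor of `S⁻¹L`. -/
theorem lie_mk_pow_char {p : ℕ} (hp : (p : R) = 0) (a : LocalizedModule S L) (s : S) :
    ⁅a, (Localization.mk 1 (s ^ p) : Localization S)⁆ = 0 := by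
  -- The fraction is itself a `p`-th power, and `p = 0` also holds in `S⁻¹R`.
  have h : (Localization.mk 1 (s ^ p) : Localization S) = Localization.mk 1 s ^ p := by
    rw [Localization.mk_pow, one_pow]
  rw [h]
  refine LieRinehartRing.lie_pow_char ?_ a _
  rw [← map_natCast (algebraMap R (Localization S)), hp, map_zero]

/-! ### The `p`-operation on `S⁻¹L` -/

section PowLocalized

variable {p : ℕ} {pow : L → L}

theorem pow_pow_char_smul (hp : p.Prime) (hR : (p : R) = 0)
    (hpow : IsRestrictedLieRinehart K R L p pow) (r : R) (x : L) :
    pow (r ^ p • x) = r ^ (p * p) • pow x := by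
  rw [hpow.pow_const_smul (fun y ↦ LieRinehartRing.lie_pow_char hR y r) hp, pow_mul]

/-- The `p`-operation of `S⁻¹L`, obtained from `x / s = s ^ (p - 1) x / s ^ p`. -/
noncomputable def powLocalized (hp : p.Prime) (hR : (p : R) = 0)
    (hpow : IsRestrictedLieRinehart K R L p pow) (a : LocalizedModule S L) :
    LocalizedModule S L :=
  a.liftOn (fun a ↦ LocalizedModule.mk (pow (a.2 ^ (p - 1) • a.1)) (a.2 ^ (p * p)))
    (liftOn_wd S (by
      intro u x s
      -- Expanding `x / s` by `u` multiplies the numerator by the constant `u ^ p`. Its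
      -- `p`-operation then gains `u ^ (p * p)`, exactly as the denominator does.
      have h : (u * s) ^ (p - 1) • u • x = (u : R) ^ p • s ^ (p - 1) • x := by
        simp only [Submonoid.smul_def, smul_smul, SubmonoidClass.coe_pow, Submonoid.coe_mul,
          ← pow_sub_one_mul hp.ne_zero (u : R)]
        congr 1
        ring
      simp only
      rw [h, pow_pow_char_smul hp hR hpow, mul_pow,
        ← mk_congr_denom S (u ^ (p * p)) (pow (s ^ (p - 1) • x))]
      rfl))

variable (hp : p.Prime) (hR : (p : R) = 0) (hpow : IsRestrictedLieRinehart K R L p pow)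

theorem powLocalized_mk (x : L) (s : S) :
    powLocalized S hp hR hpow (LocalizedModule.mk x s) =
      LocalizedModule.mk (pow (s ^ (p - 1) • x)) (s ^ (p * p)) :=
  rfl

/-- The working form of the definition: the axioms, the anchor property and uniqueness are checked
through it alone. The surplus factor `s ^ ((p - 1) * (p * p))` cancels. -/
theorem powLocalized_const_smul (x : L) (s : S) :
    powLocalized S hp hR hpow ((Localization.mk 1 (s ^ p) : Localization S) •
        LocalizedModule.mk x 1) =
      (Localization.mk 1 (s ^ p) : Localization S) ^ p • LocalizedModule.mk (pow x) 1 := by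
  have h : (s ^ p) ^ (p - 1) • x = ((s : R) ^ (p - 1)) ^ p • x := by
    rw [Submonoid.smul_def, SubmonoidClass.coe_pow, SubmonoidClass.coe_pow, pow_right_comm]
  rw [Localization.mk_pow, one_pow, ← smul_mk_one, ← smul_mk_one, powLocalized_mk, h,
    pow_pow_char_smul hp hR hpow,
    ← mk_congr_denom S ((s ^ (p - 1)) ^ (p * p)) (pow x)]
  congr 1
  rw [← pow_mul, ← pow_mul, ← pow_mul, ← pow_add]
  congr 1
  obtain ⟨n, rfl⟩ := Nat.exists_eq_succ_of_ne_zero hp.ne_zero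
  simp only [Nat.succ_eq_add_one, Nat.add_sub_cancel]
  ring

/-- `(x / s)^[p] = (s x^[p] - x^(p-1)(s) x) / s ^ (p + 1)`. -/
theorem powLocalized_mk_eq (x : L) (s : S) :
    powLocalized S hp hR hpow (LocalizedModule.mk x s) =
      LocalizedModule.mk
        ((s : R) • pow x - ((LieModule.toEnd K L R x ^ (p - 1)) (s : R)) • x) (s ^ (p + 1)) := by
  -- The element `s (s ^ (p - 1) x) = s ^ p x` is evaluated by the rule for ring scalars and by
  -- homogeneity over the constant `s ^ p`.
  have h := hpow.pow_smul_ring (s : R) (s ^ (p - 1) • x)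
  have hs : (s : R) • s ^ (p - 1) • x = (s : R) ^ p • x := by
    rw [Submonoid.smul_def, smul_smul, SubmonoidClass.coe_pow, mul_pow_sub_one hp.ne_zero]
  have hc (y : L) : ⁅y, (s : R) ^ p⁆ = 0 := LieRinehartRing.lie_pow_char hR y _
  rw [hs, pow_pow_char_smul hp hR hpow, toEnd_const_smul_pow hc] at h
  rw [powLocalized_mk, LocalizedModule.mk_eq]
  refine ⟨1, ?_⟩
  rw [one_smul, one_smul]
  -- Solved for `s ^ p (s ^ (p - 1) x)^[p]`; one more factor `s` gives the denominator `s ^ (p +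
  -- 1)`.
  have h' := eq_sub_of_add_eq h.symm
  simp only [Submonoid.smul_def, SubmonoidClass.coe_pow] at h' ⊢
  rw [pow_succ', mul_smul, h', smul_sub, smul_sub, smul_smul, smul_smul, smul_smul, smul_smul,
    smul_smul]
  congr 2
  · ring
  · obtain ⟨n, rfl⟩ := Nat.exists_eq_succ_of_ne_zero hp.ne_zero
    simp only [Nat.succ_eq_add_one, Nat.add_sub_cancel]
    ring

theorem isRestrictedLieRinehart_powLocalized :
    IsRestrictedLieRinehart K (Localization S) (LocalizedModule S L) p
      (powLocalized S hp hR hpow) := by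
  have hconst := lie_mk_pow_char (L := L) S hR
  have smul_ring (q : Localization S) (a : LocalizedModule S L) :
      powLocalized S hp hR hpow (q • a) = q ^ p • powLocalized S hp hR hpow a +
        ((LieModule.toEnd K (LocalizedModule S L) (Localization S) (q • a) ^ (p - 1)) q) • a := by
    obtain ⟨s, x, rfl⟩ := exists_mk_eq_const_smul S hp.ne_zero a
    obtain ⟨t, r, rfl⟩ := exists_mk_eq_const_mul S hp.ne_zero q
    have h : ((Localization.mk 1 (t ^ p) * Localization.mk r 1 : Localization S) •
        (Localization.mk 1 (s ^ p) : Localization S) •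
          (LocalizedModule.mk x 1 : LocalizedModule S L)) =
        (Localization.mk 1 ((s * t) ^ p) : Localization S) • LocalizedModule.mk (r • x) 1 := by
      simp [smul_smul, LocalizedModule.mk_smul_mk, Localization.mk_mul, mul_pow, mul_comm]
    have hst : (Localization.mk 1 ((s * t) ^ p) : Localization S) =
        Localization.mk 1 (s ^ p) * Localization.mk 1 (t ^ p) := by
      rw [Localization.mk_mul, one_mul, mul_pow]
    have hr : (LocalizedModule.mk (r ^ p • pow x) 1 : LocalizedModule S L) =
        (Localization.mk r 1 : Localization S) ^ p • LocalizedModule.mk (pow x) 1 := by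
      rw [Localization.mk_pow, LocalizedModule.mk_smul_mk, one_pow, one_mul]
    have hw (w : R) : (LocalizedModule.mk (w • x) 1 : LocalizedModule S L) =
        (Localization.mk w 1 : Localization S) • LocalizedModule.mk x 1 := by
      rw [LocalizedModule.mk_smul_mk, one_mul]
    have hadd (y z : L) : (LocalizedModule.mk (y + z) 1 : LocalizedModule S L) =
        LocalizedModule.mk y 1 + LocalizedModule.mk z 1 :=
      (LocalizedModule.mkLinearMap S L).map_add y z
    -- With `c = 1 / s ^ p` and `d = 1 / t ^ p`, the correction term yields `(c d) ^ (p - 1)` from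
    -- the operator, `d` from its argument and `c` from `a`: in total `(c d) ^ p`, as in the other
    -- terms.
    rw [h, powLocalized_const_smul, powLocalized_const_smul, hpow.pow_smul_ring,
      toEnd_const_smul_pow (fun y ↦ hconst y (s * t)), toEnd_pow_const_mul (fun y ↦ hconst y t),
      toEnd_mk_one_pow, hadd, hr, hw, hst]
    generalize (Localization.mk 1 (s ^ p) : Localization S) = c
    generalize (Localization.mk 1 (t ^ p) : Localization S) = d
    obtain ⟨n, rfl⟩ := Nat.exists_eq_succ_of_ne_zero hp.ne_zero
    simp only [Nat.succ_eq_add_one, Nat.add_sub_cancel, smul_add, smul_smul]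
    congr 2 <;> ring
  refine ⟨⟨?_, ?_, ?_⟩, smul_ring⟩
  · intro k a
    -- Scalars from `K` are constants, so this axiom is a case of `smul_ring`.
    have hk (b : LocalizedModule S L) : ⁅b, algebraMap K (Localization S) k⁆ = 0 :=
      lie_algebraMap S K k b
    rw [← algebraMap_smul (Localization S) k a, smul_ring,
      toEnd_pow_eq_zero (Nat.sub_ne_zero_of_lt hp.one_lt) (hk _), zero_smul, add_zero, ← map_pow,
      algebraMap_smul]
  · intro a b
    obtain ⟨s, x, y, rfl, rfl⟩ := exists_common_mk_eq_const_smul S hp.ne_zero a b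
    have hcp (z : LocalizedModule S L) :
        ⁅z, (Localization.mk 1 (s ^ p) : Localization S) ^ p⁆ = 0 := by
      rw [LieRinehartRing.lie_pow, hconst, mul_zero]
    rw [powLocalized_const_smul, ad_const_smul_pow (fun y ↦ hconst y _),
      ad_pow_const_smul (fun y ↦ hconst y _), ad_mk_one_pow, const_smul_lie hcp,
      lie_const_smul (fun y ↦ hconst y _), lie_mk_one, hpow.pow_lie]
  · intro a b
    -- A common denominator lets one constant factor out of the sum; every Jacobson term then scales
    -- by its `p`-th power.
    obtain ⟨s, x, y, rfl, rfl⟩ := exists_common_mk_eq_const_smul S hp.ne_zero a b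
    have hadd (y z : L) : (LocalizedModule.mk (y + z) 1 : LocalizedModule S L) =
        LocalizedModule.mk y 1 + LocalizedModule.mk z 1 :=
      map_add (LocalizedModule.mkLinearMap S L) y z
    have hsum (f : ℕ → L) (t : Finset ℕ) :
        (LocalizedModule.mk (∑ i ∈ t, f i) 1 : LocalizedModule S L) =
          ∑ i ∈ t, LocalizedModule.mk (f i) 1 :=
      map_sum (LocalizedModule.mkLinearMap S L) f t
    rw [← smul_add, ← hadd, powLocalized_const_smul, hpow.pow_add, hadd, hadd, hsum]
    simp only [powLocalized_const_smul, smul_add, Finset.smul_sum,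
      jacobsonTerm_const_smul (fun y ↦ hconst y _) hp.ne_zero, jacobsonTerm_mk_one]

theorem anchorIsRestricted_powLocalized (h : AnchorIsRestricted K R L p pow) :
    AnchorIsRestricted K (Localization S) (LocalizedModule S L) p
      (powLocalized S hp hR hpow) := by
  have hconst := lie_mk_pow_char (L := L) S hR
  intro a q
  obtain ⟨s, x, rfl⟩ := exists_mk_eq_const_smul S hp.ne_zero a
  obtain ⟨t, r, rfl⟩ := exists_mk_eq_const_mul S hp.ne_zero q
  rw [powLocalized_const_smul, toEnd_const_smul_pow (fun y ↦ hconst y _),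
    toEnd_pow_const_mul (fun y ↦ hconst y _), LieRinehartRing.lie_smul_eq_mul,
    lie_const_mul (fun y ↦ hconst y _), mk_one_lie_mk_one, toEnd_mk_one_pow, h]

/-- Homogeneity over the constants `1 / s ^ p` determines `q` from its values on the elements `x /
1`. -/
theorem eq_powLocalized {q : LocalizedModule S L → LocalizedModule S L}
    (hq : IsRestrictedLieRinehart K (Localization S) (LocalizedModule S L) p q)
    (h : ∀ x : L, q (LocalizedModule.mk x 1) = LocalizedModule.mk (pow x) 1) :
    q = powLocalized S hp hR hpow := by
  funext a
  obtain ⟨s, x, rfl⟩ := exists_mk_eq_const_smul S hp.ne_zero a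
  rw [hq.pow_const_smul (fun y ↦ lie_mk_pow_char S hR y s) hp, h, powLocalized_const_smul]

end PowLocalized

end LieRinehartLocalization

theorem mainTheorem2 {K R L : Type*} [CommRing K] [CommRing R] [Algebra K R]
    [LieRing L] [LieAlgebra K L] [Module R L] [LieRingModule L R] [LieRinehartRing R L]
    [LieRinehartAlgebra K R L] (p : ℕ) (hp : p.Prime) [CharP K p]
    (pow : L → L) (hpow : IsRestrictedLieRinehart K R L p pow) (S : Submonoid R) :
    (∃ powS : LocalizedModule S L → LocalizedModule S L,
      (∀ (x : L) (s : S), powS (LocalizedModule.mk x s) =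
        LocalizedModule.mk
          ((s : R) • pow x - ((LieModule.toEnd K L R x ^ (p - 1)) (s : R)) • x) (s ^ (p + 1))) ∧
      IsRestrictedLieRinehart K (Localization S) (LocalizedModule S L) p powS ∧
      (AnchorIsRestricted K R L p pow →
        AnchorIsRestricted K (Localization S) (LocalizedModule S L) p powS)) ∧
    (∀ q : LocalizedModule S L → LocalizedModule S L,
      IsRestrictedLieRinehart K (Localization S) (LocalizedModule S L) p q →
      (∀ x : L, q (LocalizedModule.mk x 1) = LocalizedModule.mk (pow x) 1) →
      ∀ (x : L) (s : S), q (LocalizedModule.mk x s) =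
        LocalizedModule.mk
          ((s : R) • pow x - ((LieModule.toEnd K L R x ^ (p - 1)) (s : R)) • x) (s ^ (p + 1))) := by
  -- Only `p = 0` in `R` is needed, which also covers `R = 0`.
  have hR : (p : R) = 0 := natCast_eq_zero_of_algebra K p
  refine ⟨⟨LieRinehartLocalization.powLocalized S hp hR hpow,
    LieRinehartLocalization.powLocalized_mk_eq S hp hR hpow,
    LieRinehartLocalization.isRestrictedLieRinehart_powLocalized S hp hR hpow,
    LieRinehartLocalization.anchorIsRestricted_powLocalized S hp hR hpow⟩, ?_⟩
  intro q hq h x s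
  rw [LieRinehartLocalization.eq_powLocalized S hp hR hpow hq h,
    LieRinehartLocalization.powLocalized_mk_eq]
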